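/- Let $K$ be a Polish space. Let $\operatorname{DSC}(K)$ be the set of functions $f:K\to\mathbb R$ for which there are continuous functions $f_n:K\to\mathbb R$ with $f_n\to f$ pointwise and $\sum_{n}|f_{n+1}(k)-f_n(k)|<\infty$ for every $k\in K$ (equivalently, the differences of semi-continuous real functions on $K$). For $g:K\to[0,\infty]$ and $x\in K$ put $\varlimsup_{y\to x}g(y)=\inf_U\sup_{y\in U}g(y)$, the infimum over all open neighborhoods $U$ of $x$, and let $\mathbf U g(x)=\varlimsup_{y\to x}g(y)$ be the upper semi-continuous envelope of $g$. For $f:K\to\mathbb R$ define the transfinite oscillations $\operatorname{osc}_\alpha f:K\to[0,\infty]$ by induction: $\operatorname{osc}_0 f=0$; $\operatorname{osc}_{\beta}f=\mathbf U\,\widetilde{\operatorname{osc}}_{\beta}f$ for $\beta>0$, where $$\widetilde{\operatorname{osc}}_{\alpha+1}f(x)=\varlimsup_{y\to x}\bigl(|f(y)-f(x)|+\operatorname{osc}_\alpha f(y)\bigr),\qquad \widetilde{\operatorname{osc}}_\beta f=\sup_{\alpha<\beta}\operatorname{osc}_\alpha f\ \text{ for limit ordinals }\beta .$$ A series $\sum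 g_j$ of $(\mathbb R\cup\{\infty\})$-valued functions on $K$ is said to converge locally uniformly if every $x\in K$ has a neighborhood $U$ and an index $\nu$ such that $g_j|_U$ is real-valued for all $j\ge\nu$ and $\sum_{j\ge\nu}g_j$ converges uniformly on $U$. A series of real-valued functions converges locally uniformly to $f:K\to\mathbb R$ if every $x\in K$ has a neighborhood on which its partial sums converge uniformly to $f$. Let $(\varphi_j)$ be a sequence in $\operatorname{DSC}(K)$ and let $f:K\to\mathbb R$ be such that (i) $\sum\varphi_j$ converges locally uniformly to $f$, and (ii) $\sum\operatorname{osc}_\alpha\varphi_j$ converges locally uniformly for every ordinal $\alpha<\omega_1$. Then $f\in\operatorname{DSC}(K)$. -/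

import Mathlib

open Filter Topology
open scoped ENNReal

/-- `DSC(K)`: the real functions `f` on `K` that are the pointwise limit of a sequence of continuous
real functions `F n` with `∑ |F (n+1) k - F n k| < ∞` at every point `k` of `K`. -/
def IsDSC {K : Type*} [TopologicalSpace K] (f : K → ℝ) : Prop :=
  ∃ F : ℕ → K → ℝ, (∀ n, Continuous (F n)) ∧
    (∀ k, Tendsto (fun n => F n k) atTop (𝓝 (f k))) ∧
    ∀ k, Summable (fun n => |F (n + 1) k - F n k|)

/-- The upper semi-continuous envelope `𝐔 g`. The filter `𝓝 x` contains only sets to which `x`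
belongs, so this is the unrestricted upper limit `inf_U sup g(U)`, `U` over the open
neighbourhoods of `x`. -/
noncomputable def uscEnvelope {K : Type*} [TopologicalSpace K] (g : K → ℝ≥0∞) (x : K) : ℝ≥0∞ :=
  limsup g (𝓝 x)

/-- The transfinite oscillations `osc_α f : K → [0, ∞]`, by recursion on the ordinal `α`:
the zero function at `0`, the upper semi-continuous envelope of
`x ↦ limsup_{y → x} (|f y - f x| + osc_α f y)` at `α + 1`,
and the upper semi-continuous envelope of `sup_{α < β} osc_α f` at a limit ordinal `β`. -/
noncomputable def osc {K : Type*} [TopologicalSpace K] (f : K → ℝ) (α : Ordinal.{0}) :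
    K → ℝ≥0∞ :=
  Ordinal.limitRecOn (motive := fun _ => K → ℝ≥0∞) α
    (fun _ => 0)
    (fun _ g => uscEnvelope
      (fun x => limsup (fun y => ENNReal.ofReal |f y - f x| + g y) (𝓝 x)))
    (fun β _ g => uscEnvelope (fun x => ⨆ (α : Ordinal.{0}) (h : α < β), g α h x))

theorem uscEnvelope_eq {K : Type*} [TopologicalSpace K] (g : K → ℝ≥0∞) (x : K) :
    uscEnvelope g x = ⨅ (U : Set K) (_ : x ∈ U ∧ IsOpen U), ⨆ y ∈ U, g y :=
  (nhds_basis_opens x).limsup_eq_iInf_iSup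

theorem osc_zero {K : Type*} [TopologicalSpace K] (f : K → ℝ) (x : K) : osc f 0 x = 0 := by
  simp [osc]

theorem osc_succ {K : Type*} [TopologicalSpace K] (f : K → ℝ) (α : Ordinal.{0}) :
    osc f (α + 1) = uscEnvelope
      (fun x => limsup (fun y => ENNReal.ofReal |f y - f x| + osc f α y) (𝓝 x)) := by
  simp [osc, Ordinal.limitRecOn_add_one]

theorem osc_limit {K : Type*} [TopologicalSpace K] (f : K → ℝ) (β : Ordinal.{0})
    (hβ : Order.IsSuccLimit β) :
    osc f β = uscEnvelope (fun x => ⨆ (α : Ordinal.{0}) (_ : α < β), osc f α x) := by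
  simp [osc, Ordinal.limitRecOn_limit _ _ _ _ hβ]

/-- The series `∑ φ j` of real functions converges locally uniformly to `f`: every point has a
neighbourhood on which the partial sums converge uniformly to `f`. -/
def SeriesConvergesLocallyUniformlyTo {K : Type*} [TopologicalSpace K]
    (φ : ℕ → K → ℝ) (f : K → ℝ) : Prop :=
  ∀ x, ∃ U ∈ 𝓝 x,
    TendstoUniformlyOn (fun n y => ∑ j ∈ Finset.range n, φ j y) f atTop U

/-- The series `∑ g j` of `[0, ∞]`-valued functions converges locally uniformly: every point has a
neighbourhood `U` and a `ν` such that `g j` is finite on `U` for all `j ≥ ν` and the series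
`∑_{j ≥ ν} g j` of real functions converges uniformly on `U`. -/
def SeriesConvergesLocallyUniformly {K : Type*} [TopologicalSpace K]
    (g : ℕ → K → ℝ≥0∞) : Prop :=
  ∀ x, ∃ U ∈ 𝓝 x, ∃ ν : ℕ, (∀ j ≥ ν, ∀ y ∈ U, g j y ≠ ∞) ∧
    ∃ s : K → ℝ,
      TendstoUniformlyOn (fun n y => ∑ j ∈ Finset.Ico ν n, (g j y).toReal) s atTop U

/-! For each `j` the functions `osc (φ j) α` increase with `α` and are upper semi-continuous, so
second countability makes them all stationary from one `α < ω₁` on. There `v j = osc (φ j) α`, where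
finite, satisfies `limsup_{y → x} (|φ j y - φ j x| + v j y) ≤ v j x`. This inequality survives sums
and uniform limits, so locally it passes to a tail of `∑ φ j`, dominated by the tail of `∑ v j`. It
makes `v + f` and `v - f` upper semi-continuous, which exhibits the tail locally as a difference of
semi-continuous functions. The finitely many other terms are DSC by hypothesis, and a partition of
unity globalizes. -/

section Algebra

variable {X Y : Type*} [TopologicalSpace X] [TopologicalSpace Y]

theorem IsDSC.comp_continuous {f : X → ℝ} (hf : IsDSC f) {g : Y → X} (hg : Continuous g) :
    IsDSC (fun y => f (g y)) := by
  obtain ⟨F, hc, ht, hs⟩ := hf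
  exact ⟨fun n y => F n (g y), fun n => (hc n).comp hg, fun y => ht (g y), fun y => hs (g y)⟩

theorem Continuous.isDSC {f : X → ℝ} (hf : Continuous f) : IsDSC f :=
  ⟨fun _ => f, fun _ => hf, fun _ => tendsto_const_nhds, fun _ => by simp⟩

theorem IsDSC.add {f g : X → ℝ} (hf : IsDSC f) (hg : IsDSC g) :
    IsDSC (fun x => f x + g x) := by
  obtain ⟨F, hFc, hFt, hFs⟩ := hf
  obtain ⟨G, hGc, hGt, hGs⟩ := hg
  refine ⟨fun n x => F n x + G n x, fun n => (hFc n).add (hGc n),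
    fun x => (hFt x).add (hGt x), fun x => ?_⟩
  refine Summable.of_nonneg_of_le (fun _ => abs_nonneg _) (fun n => ?_) ((hFs x).add (hGs x))
  rw [add_sub_add_comm]
  exact abs_add_le _ _

theorem IsDSC.neg {f : X → ℝ} (hf : IsDSC f) : IsDSC (fun x => -f x) := by
  obtain ⟨F, hc, ht, hs⟩ := hf
  refine ⟨fun n x => -F n x, fun n => (hc n).neg, fun x => (ht x).neg, fun x => ?_⟩
  refine (hs x).congr fun n => ?_
  rw [← abs_neg, neg_sub, neg_sub_neg, abs_sub_comm]

theorem IsDSC.sub {f g : X → ℝ} (hf : IsDSC f) (hg : IsDSC g) :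
    IsDSC (fun x => f x - g x) := by
  simpa only [sub_eq_add_neg] using hf.add hg.neg

theorem IsDSC.sum {ι : Type*} (s : Finset ι) {f : ι → X → ℝ} (hf : ∀ i ∈ s, IsDSC (f i)) :
    IsDSC (fun x => ∑ i ∈ s, f i x) := by
  classical
  induction s using Finset.induction_on with
  | empty => simpa using (continuous_const (y := (0 : ℝ))).isDSC
  | insert a s ha ih =>
    simp only [Finset.sum_insert ha]
    exact (hf a (by simp)).add (ih fun i hi => hf i (by simp [hi]))

end Algebra

/-! ### Lipschitz approximation from below. -/

section LipschitzRegularization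

variable {X : Type*} [MetricSpace X]

/-- The largest `n`-Lipschitz minorant of a function. -/
noncomputable def lipschitzRegularization (u : X → ℝ) (n : ℕ) (x : X) : ℝ :=
  ⨅ y, (u y + n * dist x y)

theorem bddBelow_lipschitzRegularization {u : X → ℝ} (hu : ∀ x, 0 ≤ u x) (n : ℕ) (x : X) :
    BddBelow (Set.range fun y => u y + n * dist x y) :=
  ⟨0, by rintro _ ⟨y, rfl⟩; have := hu y; positivity⟩

theorem lipschitzRegularization_le {u : X → ℝ} (hu : ∀ x, 0 ≤ u x) (n : ℕ) (x : X) :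
    lipschitzRegularization u n x ≤ u x :=
  (ciInf_le (bddBelow_lipschitzRegularization hu n x) x).trans_eq (by simp)

theorem lipschitzRegularization_nonneg {u : X → ℝ} (hu : ∀ x, 0 ≤ u x) (n : ℕ) (x : X) :
    0 ≤ lipschitzRegularization u n x :=
  Real.iInf_nonneg fun y => by have := hu y; positivity

theorem lipschitzRegularization_le_succ {u : X → ℝ} (hu : ∀ x, 0 ≤ u x) (n : ℕ) (x : X) :
    lipschitzRegularization u n x ≤ lipschitzRegularization u (n + 1) x := by
  refine ciInf_mono (bddBelow_lipschitzRegularization hu n x) fun y => ?_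
  push_cast
  gcongr
  linarith

theorem continuous_lipschitzRegularization {u : X → ℝ} (hu : ∀ x, 0 ≤ u x) (n : ℕ) :
    Continuous (lipschitzRegularization u n) := by
  refine (LipschitzWith.of_le_add_mul (n : NNReal) fun x y => ?_).continuous
  have : Nonempty X := ⟨x⟩
  rw [← sub_le_iff_le_add]
  refine le_ciInf fun z => ?_
  have h1 := ciInf_le (bddBelow_lipschitzRegularization hu n x) z
  have h2 : (n : ℝ) * dist x z ≤ n * (dist x y + dist y z) := by
    gcongr; exact dist_triangle _ _ _
  simp only [lipschitzRegularization, NNReal.coe_natCast] at *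
  linarith

theorem tendsto_lipschitzRegularization {u : X → ℝ} (hu : ∀ x, 0 ≤ u x)
    (hl : LowerSemicontinuous u) (x : X) :
    Tendsto (fun n => lipschitzRegularization u n x) atTop (𝓝 (u x)) := by
  have : Nonempty X := ⟨x⟩
  rw [Metric.tendsto_atTop]
  intro ε hε
  obtain ⟨δ, hδ, hball⟩ := Metric.eventually_nhds_iff.1 (hl x (u x - ε / 2) (by linarith))
  -- Once `n * δ ≥ u x`, points at distance at least `δ` cannot push the infimum below `u x`.
  obtain ⟨N, hN⟩ := exists_nat_ge (u x / δ)
  refine ⟨N, fun n hn => ?_⟩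
  have hnδ : u x ≤ n * δ := by
    rw [div_le_iff₀ hδ] at hN
    refine hN.trans ?_
    gcongr
  have hle := lipschitzRegularization_le hu n x
  have hge : u x - ε / 2 ≤ lipschitzRegularization u n x := by
    refine le_ciInf fun y => ?_
    rcases lt_or_ge (dist y x) δ with h | h
    · have h1 := hball h
      have h2 : 0 ≤ (n : ℝ) * dist x y := by positivity
      linarith
    · rw [dist_comm] at h
      have h1 : (n : ℝ) * δ ≤ n * dist x y := by gcongr
      have h2 := hu y
      linarith
  rw [Real.dist_eq, abs_lt]
  constructor <;> linarith

end LipschitzRegularization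

/-- The approximations increase, so their absolute differences telescope to at most `u x`. -/
theorem LowerSemicontinuous.isDSC {X : Type*} [TopologicalSpace X]
    [TopologicalSpace.MetrizableSpace X] {u : X → ℝ} (hl : LowerSemicontinuous u)
    (hu : ∀ x, 0 ≤ u x) : IsDSC u := by
  let := TopologicalSpace.metrizableSpaceMetric X
  refine ⟨lipschitzRegularization u, continuous_lipschitzRegularization hu,
    tendsto_lipschitzRegularization hu hl, fun x => ?_⟩
  have habs : ∀ n, |lipschitzRegularization u (n + 1) x - lipschitzRegularization u n x| =
      lipschitzRegularization u (n + 1) x - lipschitzRegularization u n x := fun n =>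
    abs_of_nonneg (sub_nonneg.2 (lipschitzRegularization_le_succ hu n x))
  refine summable_of_sum_range_le (c := u x) (fun _ => abs_nonneg _) fun n => ?_
  simp only [habs]
  rw [Finset.sum_range_sub (fun n => lipschitzRegularization u n x)]
  linarith [lipschitzRegularization_le hu n x, lipschitzRegularization_nonneg hu 0 x]

/-- `f` is a difference of semi-continuous functions in a neighbourhood of every point. -/
def IsLocallyDSC {X : Type*} [TopologicalSpace X] (f : X → ℝ) : Prop :=
  ∀ x, ∃ U : Set X, IsOpen U ∧ x ∈ U ∧ IsDSC (fun y : U => f y)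

theorem IsLocallyDSC.isDSC {X : Type*} [TopologicalSpace X] [NormalSpace X] [ParacompactSpace X]
    {f : X → ℝ} (hf : IsLocallyDSC f) : IsDSC f := by
  classical
  choose U hUo hxU hU using hf
  choose F hFc hFt hFs using hU
  obtain ⟨ρ, hρ⟩ := PartitionOfUnity.exists_isSubordinate isClosed_univ U hUo
    (fun x _ => Set.mem_iUnion.2 ⟨x, hxU x⟩)
  -- The value `0` off `U i` is harmless: the closed support of `ρ i` lies in `U i`.
  let G : ℕ → X → X → ℝ := fun n i y => if h : y ∈ U i then F i n ⟨y, h⟩ else 0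
  have hG : ∀ n i y (h : y ∈ U i), G n i y = F i n ⟨y, h⟩ := fun n i y h => dif_pos h
  have hsum : ∀ (g : X → ℝ) (y : X),
      ∑ᶠ i, ρ i y • g i = ∑ i ∈ ρ.finsupport y, ρ i y * g i := fun g y => by
    refine finsum_eq_sum_of_support_subset _ fun i hi => ?_
    rw [PartitionOfUnity.coe_finsupport]
    exact Function.support_smul_subset_left _ _ hi
  have hmem : ∀ y, ∀ i ∈ ρ.finsupport y, y ∈ U i := fun y i hi => by
    rw [PartitionOfUnity.mem_finsupport] at hi
    exact hρ i (subset_tsupport _ hi)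
  refine ⟨fun n y => ∑ᶠ i, ρ i y • G n i y, fun n => ?_, fun y => ?_, fun y => ?_⟩
  · refine ρ.continuous_finsum_smul fun i y hy => ?_
    have hyU : y ∈ U i := hρ i hy
    refine ContinuousOn.continuousAt (s := U i) ?_ ((hUo i).mem_nhds hyU)
    rw [continuousOn_iff_continuous_domRestrict]
    refine (hFc i n).congr fun z => ?_
    exact (hG n i z z.2).symm
  · have hfy : f y = ∑ i ∈ ρ.finsupport y, ρ i y * f y := by
      rw [← Finset.sum_mul, ρ.sum_finsupport (Set.mem_univ y), one_mul]
    simp only [hsum]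
    rw [hfy]
    refine tendsto_finsetSum _ fun i hi => Tendsto.const_mul _ ?_
    simp only [hG _ i y (hmem y i hi)]
    exact hFt i ⟨y, hmem y i hi⟩
  · simp only [hsum, ← Finset.sum_sub_distrib]
    refine Summable.of_nonneg_of_le (fun _ => abs_nonneg _)
      (fun n => Finset.abs_sum_le_sum_abs _ _) (summable_sum fun i hi => ?_)
    simp only [hG _ i y (hmem y i hi), ← mul_sub, abs_mul]
    exact (hFs i ⟨y, hmem y i hi⟩).mul_left _

/-! ### Functions that dominate an oscillation. -/

/-- `limsup_{y → x} (|f y - f x| + v y) ≤ v x` at every point `x`. -/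
def DominatesOscillation {X : Type*} [TopologicalSpace X] (v f : X → ℝ) : Prop :=
  ∀ x, ∀ ε > 0, ∀ᶠ y in 𝓝 x, |f y - f x| + v y < v x + ε

namespace DominatesOscillation

variable {X : Type*} [TopologicalSpace X]

theorem add {v w f g : X → ℝ} (hf : DominatesOscillation v f) (hg : DominatesOscillation w g) :
    DominatesOscillation (fun x => v x + w x) (fun x => f x + g x) := by
  intro x ε hε
  filter_upwards [hf x (ε / 2) (half_pos hε), hg x (ε / 2) (half_pos hε)] with y h1 h2
  have h3 := abs_add_le (f y - f x) (g y - g x)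
  rw [← add_sub_add_comm] at h3
  linarith

theorem sum {ι : Type*} (s : Finset ι) {v f : ι → X → ℝ}
    (h : ∀ i ∈ s, DominatesOscillation (v i) (f i)) :
    DominatesOscillation (fun x => ∑ i ∈ s, v i x) (fun x => ∑ i ∈ s, f i x) := by
  classical
  induction s using Finset.induction_on with
  | empty => intro x ε hε; simpa using hε
  | insert a s ha ih =>
    simp only [Finset.sum_insert ha]
    exact (h a (by simp)).add (ih fun i hi => h i (by simp [hi]))

theorem of_tendstoUniformly {ι : Type*} {l : Filter ι} [l.NeBot] {V F : ι → X → ℝ}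
    {v f : X → ℝ} (h : ∀ᶠ i in l, DominatesOscillation (V i) (F i))
    (hv : TendstoUniformly V v l) (hf : TendstoUniformly F f l) : DominatesOscillation v f := by
  intro x ε hε
  -- Two errors come from `v`, two from `f`, one from the inequality for `V i` and `F i`.
  have hε' : 0 < ε / 5 := by positivity
  obtain ⟨i, hi, h1, h2⟩ := (h.and ((Metric.tendstoUniformly_iff.1 hv _ hε').and
    (Metric.tendstoUniformly_iff.1 hf _ hε'))).exists
  filter_upwards [hi x _ hε'] with y hy
  have a1 := abs_lt.1 (h1 x)
  have a2 := abs_lt.1 (h1 y)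
  have a3 := abs_lt.1 (h2 x)
  have a4 := abs_lt.1 (h2 y)
  have a5 : |f y - f x| ≤ |F i y - F i x| + 2 * (ε / 5) := by
    have := abs_le.1 (le_refl |F i y - F i x|)
    rw [abs_le]
    constructor <;> linarith [a3.1, a3.2, a4.1, a4.2, this.1, this.2]
  linarith [a1.1, a1.2, a2.1, a2.2]

theorem comp_continuous {Y : Type*} [TopologicalSpace Y] {v f : X → ℝ}
    (h : DominatesOscillation v f) {g : Y → X} (hg : Continuous g) :
    DominatesOscillation (fun y => v (g y)) (fun y => f (g y)) :=
  fun x ε hε => hg.continuousAt.eventually (h (g x) ε hε)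

theorem neg {v f : X → ℝ} (h : DominatesOscillation v f) :
    DominatesOscillation v (fun x => -f x) := fun x ε hε => by
  filter_upwards [h x ε hε] with y hy
  rwa [← neg_sub', abs_neg]

theorem lowerSemicontinuous {v f : X → ℝ} (h : DominatesOscillation v f) (C : ℝ) :
    LowerSemicontinuous (fun x => (C - (v x + f x)) / 2) := by
  intro x r hr
  filter_upwards [h x ((C - (v x + f x)) - 2 * r) (by dsimp only at hr; linarith)] with y hy
  have := le_abs_self (f y - f x)
  linarith

theorem isLocallyDSC [TopologicalSpace.MetrizableSpace X] {v f : X → ℝ}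
    (h : DominatesOscillation v f) : IsLocallyDSC f := by
  intro x
  obtain ⟨U, hU, hUo, hxU⟩ := eventually_nhds_iff.1 (h x 1 one_pos)
  refine ⟨U, hUo, hxU, ?_⟩
  have hr := h.comp_continuous (continuous_subtype_val (p := fun y => y ∈ U))
  -- With this bound as `C`, both `(C - (v + f)) / 2` and `(C - (v - f)) / 2` are nonnegative; `f`
  -- is the second minus the first.
  have hbound : ∀ y : U, |f y| + v y ≤ v x + 1 + |f x| := fun y => by
    have h1 := hU y y.2
    have h2 := abs_add_le (f y - f x) (f x)
    rw [sub_add_cancel] at h2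
    linarith
  have hp := (hr.lowerSemicontinuous (v x + 1 + |f x|)).isDSC fun y => by
    linarith [hbound y, le_abs_self (f y)]
  have hn := (hr.neg.lowerSemicontinuous (v x + 1 + |f x|)).isDSC fun y => by
    linarith [hbound y, neg_abs_le (f y)]
  convert hn.sub hp using 2 with y
  ring

end DominatesOscillation

theorem IsLocallyDSC.of_isOpen_cover {X : Type*} [TopologicalSpace X] {f : X → ℝ}
    (h : ∀ x, ∃ U : Set X, IsOpen U ∧ x ∈ U ∧ IsLocallyDSC (fun y : U => f y)) :
    IsLocallyDSC f := by
  intro x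
  obtain ⟨U, hUo, hxU, hU⟩ := h x
  obtain ⟨V, hVo, hxV, hV⟩ := hU ⟨x, hxU⟩
  refine ⟨Subtype.val '' V, hUo.isOpenMap_subtype_val _ hVo, ⟨_, hxV, rfl⟩, ?_⟩
  have hmem : ∀ y : (Subtype.val '' V : Set X), ∃ h : (y : X) ∈ U, (⟨y, h⟩ : U) ∈ V := by
    rintro ⟨_, z, hz, rfl⟩
    exact ⟨z.2, hz⟩
  exact hV.comp_continuous
    (g := fun y : (Subtype.val '' V : Set X) => (⟨⟨y, (hmem y).1⟩, (hmem y).2⟩ : V))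
    (by fun_prop)

/-! ### Transfinite oscillations and their stabilization. -/

section Oscillation

variable {K : Type*} [TopologicalSpace K]

theorem le_limsup_nhds (g : K → ℝ≥0∞) (x : K) : g x ≤ limsup g (𝓝 x) :=
  le_limsup_of_frequently_le' (Eventually.frequently (f := pure x) (by simp) |>.filter_mono
    (pure_le_nhds x))

theorem le_uscEnvelope (g : K → ℝ≥0∞) (x : K) : g x ≤ uscEnvelope g x :=
  le_limsup_nhds g x

theorem upperSemicontinuous_uscEnvelope (g : K → ℝ≥0∞) :
    UpperSemicontinuous (uscEnvelope g) := by
  intro x r hr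
  rw [uscEnvelope_eq] at hr
  simp only [iInf_lt_iff] at hr
  obtain ⟨U, ⟨hxU, hUo⟩, hlt⟩ := hr
  filter_upwards [hUo.mem_nhds hxU] with y hy
  rw [uscEnvelope_eq]
  exact (iInf₂_le U ⟨hy, hUo⟩).trans_lt hlt

theorem osc_le_osc_add_one (f : K → ℝ) (α : Ordinal.{0}) : osc f α ≤ osc f (α + 1) := by
  intro x
  rw [osc_succ]
  refine le_trans ?_ (le_uscEnvelope _ x)
  refine le_trans ?_ (le_limsup_nhds _ x)
  simp

theorem osc_mono (f : K → ℝ) : Monotone (osc f) := by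
  intro α β h
  induction β using Ordinal.limitRecOn with
  | zero => rw [nonpos_iff_eq_zero.1 h]
  | add_one β ih =>
    rcases h.eq_or_lt with rfl | h
    · exact le_rfl
    · exact (ih (Order.lt_add_one_iff.1 h)).trans (osc_le_osc_add_one f β)
  | limit β hβ _ =>
    rcases h.eq_or_lt with rfl | h
    · exact le_rfl
    · intro x
      rw [osc_limit f β hβ]
      refine le_trans ?_ (le_uscEnvelope _ x)
      exact le_iSup₂ (f := fun (γ : Ordinal.{0}) (_ : γ < β) => osc f γ x) α h

theorem upperSemicontinuous_osc (f : K → ℝ) (α : Ordinal.{0}) :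
    UpperSemicontinuous (osc f α) := by
  induction α using Ordinal.limitRecOn with
  | zero =>
    rw [show osc f 0 = fun _ => 0 from funext (osc_zero f)]
    exact upperSemicontinuous_const
  | add_one β _ => rw [osc_succ]; exact upperSemicontinuous_uscEnvelope _
  | limit β hβ _ => rw [osc_limit f β hβ]; exact upperSemicontinuous_uscEnvelope _

/-- Countably many increasing `ω₁`-sequences of upper semi-continuous functions on a second
countable space become stationary at a common countable ordinal. -/
theorem exists_stationary_of_upperSemicontinuous [SecondCountableTopology K] {ι : Type*}
    [Countable ι] (g : ι → Ordinal.{0} → K → ℝ≥0∞) (hmono : ∀ i, Monotone (g i))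
    (husc : ∀ i α, UpperSemicontinuous (g i α)) :
    ∃ α < Ordinal.omega 1, ∀ i, ∀ β, α ≤ β → β < Ordinal.omega 1 → g i β = g i α := by
  classical
  let B := TopologicalSpace.countableBasis K
  have : Countable B := (TopologicalSpace.countable_countableBasis K).to_subtype
  -- The ordinals at which `g i` reaches level `q` somewhere on a basic open set; one is chosen per
  -- triple, and `α` is their supremum.
  let S : ι × B × ℚ → Set Ordinal.{0} := fun p =>
    {α | α < Ordinal.omega 1 ∧ ∃ y ∈ p.2.1.1, ENNReal.ofReal p.2.2 ≤ g p.1 α y}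
  let a : ι × B × ℚ → Ordinal.{0} := fun p => if h : (S p).Nonempty then h.some else 0
  have ha : ∀ p, a p < Ordinal.omega 1 := fun p => by
    by_cases h : (S p).Nonempty
    · simpa only [a, dif_pos h] using h.some_mem.1
    · simpa only [a, dif_neg h] using Ordinal.omega_pos 1
  have hα : (⨆ p, a p) < Ordinal.omega 1 := Ordinal.iSup_lt_omega_one ha
  refine ⟨_, hα, fun i β hαβ hβ => le_antisymm (fun x => ?_) (hmono i hαβ)⟩
  by_contra! hlt
  -- Growth after `α` would reach a level `q` on a basic set where `g i α < q`, yet `q` was already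
  -- reached there at an ordinal up to `α`.
  obtain ⟨q, _, hq1, hq2⟩ := ENNReal.lt_iff_exists_rat_btwn.1 hlt
  obtain ⟨V, hVB, hxV, hV⟩ := (TopologicalSpace.isBasis_countableBasis K).mem_nhds_iff.1
    (husc i _ x _ hq1)
  have hne : (S (i, ⟨V, hVB⟩, q)).Nonempty := ⟨β, hβ, x, hxV, hq2.le⟩
  have hle : a (i, ⟨V, hVB⟩, q) ≤ ⨆ p, a p := Ordinal.le_iSup a _
  have hmem : a (i, ⟨V, hVB⟩, q) ∈ S (i, ⟨V, hVB⟩, q) := by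
    simpa only [a, dif_pos hne] using hne.some_mem
  obtain ⟨_, y, hy, hqy⟩ := hmem
  exact (hqy.trans (hmono i hle y)).not_gt (hV hy)

theorem dominatesOscillation_osc {f : K → ℝ} {α : Ordinal.{0}} (h : osc f (α + 1) = osc f α)
    {U : Set K} (hfin : ∀ y ∈ U, osc f α y ≠ ∞) :
    DominatesOscillation (fun y : U => (osc f α y).toReal) (fun y : U => f y) := by
  intro x ε hε
  have hx := hfin x x.2
  have hle : limsup (fun y => ENNReal.ofReal |f y - f x| + osc f α y) (𝓝 (x : K)) ≤
      osc f α x := by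
    conv_rhs => rw [← h, osc_succ]
    exact le_uscEnvelope
      (fun z => limsup (fun y => ENNReal.ofReal |f y - f z| + osc f α y) (𝓝 z)) (x : K)
  have hlt := hle.trans_lt
    (ENNReal.lt_add_right hx (ENNReal.ofReal_pos.2 hε).ne' : _ < _ + ENNReal.ofReal ε)
  filter_upwards [continuous_subtype_val.continuousAt.eventually
    (eventually_lt_of_limsup_lt hlt)] with y hy
  have hy' := hfin y y.2
  have := (ENNReal.toReal_lt_toReal (by finiteness) (by finiteness)).2 hy
  rwa [ENNReal.toReal_add (by finiteness) hy', ENNReal.toReal_add hx (by finiteness),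
    ENNReal.toReal_ofReal (abs_nonneg _), ENNReal.toReal_ofReal hε.le] at this

end Oscillation

theorem corollary5p4 {K : Type*} [TopologicalSpace K] [PolishSpace K]
    (φ : ℕ → K → ℝ) (f : K → ℝ)
    (hφ : ∀ j, IsDSC (φ j))
    (hf : SeriesConvergesLocallyUniformlyTo φ f)
    (hosc : ∀ α : Ordinal.{0}, α < Ordinal.omega 1 →
      SeriesConvergesLocallyUniformly (fun j => osc (φ j) α)) :
    IsDSC f := by
  let := TopologicalSpace.upgradeIsCompletelyMetrizable K
  obtain ⟨α, hα, hstat⟩ := exists_stationary_of_upperSemicontinuous (fun j => osc (φ j))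
    (fun j => osc_mono (φ j)) (fun j => upperSemicontinuous_osc (φ j))
  have hsucc : ∀ j, osc (φ j) (α + 1) = osc (φ j) α := fun j =>
    hstat j _ le_self_add ((Cardinal.isSuccLimit_omega 1).add_one_lt hα)
  refine (IsLocallyDSC.of_isOpen_cover fun x => ?_).isDSC
  obtain ⟨U₁, hU₁, hfU⟩ := hf x
  obtain ⟨U₂, hU₂, ν, hfin, s, hs⟩ := hosc α hα x
  obtain ⟨U, hU, hUo, hxU⟩ := mem_nhds_iff.1 (inter_mem hU₁ hU₂)
  refine ⟨U, hUo, hxU, ?_⟩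
  have hf' := tendstoUniformlyOn_iff_tendstoUniformly_comp_coe.1
    (hfU.mono (hU.trans Set.inter_subset_left))
  have hs' := tendstoUniformlyOn_iff_tendstoUniformly_comp_coe.1
    (hs.mono (hU.trans Set.inter_subset_right))
  -- The first `ν` terms are split off because their oscillations may be infinite.
  have htail : TendstoUniformly (fun n (y : U) => ∑ j ∈ Finset.Ico ν n, φ j y)
      (fun y : U => f y - ∑ j ∈ Finset.range ν, φ j y) atTop := by
    rw [Metric.tendstoUniformly_iff] at hf' ⊢
    intro ε hε
    filter_upwards [hf' ε hε, eventually_ge_atTop ν] with n hn hνn y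
    rw [Finset.sum_Ico_eq_sub _ hνn, dist_sub_right]
    exact hn y
  have hdom := DominatesOscillation.of_tendstoUniformly
    (Eventually.of_forall fun n => DominatesOscillation.sum (Finset.Ico ν n) fun j hj =>
      dominatesOscillation_osc (hsucc j) fun y hy =>
        hfin j (Finset.mem_Ico.1 hj).1 y (hU hy).2) hs' htail
  intro y
  obtain ⟨V, hVo, hyV, hV⟩ := hdom.isLocallyDSC y
  refine ⟨V, hVo, hyV, ?_⟩
  have hfinite : IsDSC (fun z : V => ∑ j ∈ Finset.range ν, φ j (z : U)) :=
    (IsDSC.sum _ fun j _ => hφ j).comp_continuous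
      (continuous_subtype_val.comp continuous_subtype_val)
  simpa only [sub_add_cancel] using hV.add hfinite
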